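/- Let $R$ be a commutative ring. An $\mathcal R$-module is a covariant functor $\mathbb M$ from commutative $R$-algebras to abelian groups together with a natural $A$-module structure on $\mathbb M(A)$ for every commutative $R$-algebra $A$; morphisms are natural transformations that are $A$-linear at each $A$, and an $\mathcal R$-submodule of $\mathbb M$ is a family of $A$-submodules of the $\mathbb M(A)$ stable under functoriality, ordered by inclusion. For an $R$-module $M$ let $\mathcal M$ be the (quasi-coherent) $\mathcal R$-module $\mathcal M(A)=M\otimes_R A$, let $\mathcal M^*$ be its dual, $\mathcal M^*(A)=\operatorname{Hom}_A(M\otimes_R A,A)$ (the $\mathcal R$-module scheme associated with $M$), and let $\mathcal R^n(A)=A^n$. By an $\mathcal R$-submodule scheme $\mathcal W^*\subseteq\mathcal M$ we mean an $\mathcal R$-submodule of $\mathcal M$ that is isomorphic to $\mathcal W^*$ for some $R$-module $W$. An $R$-module $M$ is called a flat Mittag-Leffler module if it is the direct limit of a direct system $\{L_i\}$ of finite free $R$-modules, indexed by an upward directed set, such that for each $i$ there is $j\ge i$ with $\operatorname{Im}(L_k^*\to L_i^*)=\operatorname{Im}(L_j^*\to L_i^*)$ for all $k\ge j$, where $L_i^*=\operatorname{Hom}_R(L_i,R)$.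 Let $M$ be an $R$-module. The following statements are equivalent: (1) $M$ is a flat Mittag-Leffler module. (2) For any $R$-module $N$ and any morphism $f\colon\mathcal N^*\to\mathcal M$ there exists a smallest $\mathcal R$-submodule scheme $\mathcal W^*\subseteq\mathcal M$ such that $f$ factors through $\mathcal W^*$. (3) For any $n\ge 0$ and any morphism $f\colon\mathcal R^n\to\mathcal M$ there exists a smallest $\mathcal R$-submodule scheme $\mathcal W^*\subseteq\mathcal M$ such that $f$ factors through $\mathcal W^*$. (4) For any $n\ge 0$ and any $x\in R^n\otimes_R M$ there exist a submodule $i\colon W\hookrightarrow R^n$ and $x'\in W\otimes_R M$ such that (a) $(\phi\otimes\mathrm{Id})(x')\ne 0$ for every $R$-module $V$ and every non-zero $R$-linear map $\phi\colon W\to V$, and (b) $(i\otimes\mathrm{Id})(x')=x$. (5) For any $R$-module $N$ and any morphism $f\colon\mathcal M^*\to\mathcal N$ there exists a smallest pair $(N',f')$, where $N'$ is a submodule of $N$ and $f'\colon\mathcal M^*\to\mathcal N'$ is a morphism of $\mathcal R$-modules, such that $f$ is the composite $\mathcal M^*\xrightarrow{f'}\mathcal N'\to\mathcal N$. (Here $(N',f')\le(N'',f'')$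 means that $N'\subseteq N''$ and $f''$ is the composite $\mathcal M^*\xrightarrow{f'}\mathcal N'\to\mathcal N''$.) (6) For any $R$-module $N$ and any $x\in M\otimes_R N$ there exists a smallest pair $(N',x')$, where $N'$ is a submodule of $N$ and $x'\in M\otimes_R N'$, such that $x'$ maps to $x$ under $M\otimes_R N'\to M\otimes_R N$. (Here $(N',x')\le(N'',x'')$ means that $N'\subseteq N''$ and $x'$ maps to $x''$ under $M\otimes_R N'\to M\otimes_R N''$.) -/

import Mathlib

universe u

open scoped TensorProduct

/-- An `𝓡`-module: a covariant functor from commutative `R`-algebras to abelian groups, together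
with an action of the functor of rings `𝓡 (A) = A`, i.e. a natural `A`-module structure on the
value at every commutative `R`-algebra `A`. -/
structure ModuleFunctor (R : Type u) [CommRing R] where
  /-- The value at a commutative `R`-algebra. -/
  obj (A : Type u) [CommRing A] [Algebra R A] : Type u
  addCommGroup (A : Type u) [CommRing A] [Algebra R A] : AddCommGroup (obj A)
  module (A : Type u) [CommRing A] [Algebra R A] : Module A (obj A)
  /-- Functoriality. -/
  map {A B : Type u} [CommRing A] [Algebra R A] [CommRing B] [Algebra R B]
    (φ : A →ₐ[R] B) : obj A →+ obj B
  map_smul {A B : Type u} [CommRing A] [Algebra R A] [CommRing B] [Algebra R B]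
    (φ : A →ₐ[R] B) (a : A) (x : obj A) : map φ (a • x) = φ a • map φ x
  map_id (A : Type u) [CommRing A] [Algebra R A] (x : obj A) : map (AlgHom.id R A) x = x
  map_comp {A B C : Type u} [CommRing A] [Algebra R A] [CommRing B] [Algebra R B]
    [CommRing C] [Algebra R C] (ψ : B →ₐ[R] C) (φ : A →ₐ[R] B) (x : obj A) :
    map (ψ.comp φ) x = map ψ (map φ x)

namespace ModuleFunctor

attribute [instance] ModuleFunctor.addCommGroup ModuleFunctor.module

/-- A morphism of `𝓡`-modules: a natural transformation, linear over `A` at each `A`. -/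
@[ext]
structure Hom {R : Type u} [CommRing R] (X Y : ModuleFunctor R) where
  /-- The component at a commutative `R`-algebra. -/
  app (A : Type u) [CommRing A] [Algebra R A] : X.obj A →ₗ[A] Y.obj A
  naturality {A B : Type u} [CommRing A] [Algebra R A] [CommRing B] [Algebra R B]
    (φ : A →ₐ[R] B) (x : X.obj A) : app B (X.map φ x) = Y.map φ (app A x)

/-- Composition of morphisms of `𝓡`-modules (`g` after `f`). -/
def Hom.comp {R : Type u} [CommRing R] {X Y Z : ModuleFunctor R} (g : Hom Y Z) (f : Hom X Y) : Hom X Z where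
  app A _ _ := g.app A ∘ₗ f.app A
  naturality φ x := by
    simp only [LinearMap.comp_apply, f.naturality, g.naturality]

/-- The `𝓡`-module `𝓡ⁿ`, with `𝓡ⁿ(A) = Aⁿ`. -/
def power (R : Type u) [CommRing R] (n : ℕ) : ModuleFunctor R where
  obj A _ _ := Fin n → A
  addCommGroup _ _ _ := inferInstance
  module _ _ _ := inferInstance
  map φ := { toFun := fun x i => φ (x i)
             map_zero' := by ext i; simp
             map_add' := fun x y => by ext i; simp }
  map_smul φ a x := by ext i; simp
  map_id A _ _ x := rfl
  map_comp ψ φ x := rfl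

/-- The quasi-coherent `𝓡`-module `𝓜` associated with an `R`-module `M`:
`𝓜(A) = A ⊗[R] M`, with its structure of `A`-module on the left factor. -/
def quasiCoherent (R : Type u) [CommRing R] (M : Type u) [AddCommGroup M] [Module R M] :
    ModuleFunctor R where
  obj A _ _ := A ⊗[R] M
  addCommGroup _ _ _ := inferInstance
  module _ _ _ := inferInstance
  map φ := (LinearMap.rTensor M φ.toLinearMap).toAddMonoidHom
  map_smul φ a x := by
    induction x using TensorProduct.induction_on with
    | zero => simp
    | tmul b m => simp [TensorProduct.smul_tmul']
    | add x y hx hy => rw [smul_add, map_add, hx, hy, map_add, smul_add]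
  map_id A _ _ x := by simp
  map_comp ψ φ x := by
    induction x using TensorProduct.induction_on with
    | zero => simp
    | tmul b m => simp
    | add x y hx hy => rw [map_add, hx, hy, map_add, map_add]

/-- The morphism `𝓜 → 𝓝` of quasi-coherent `𝓡`-modules induced by a linear map `M → N`. -/
def quasiCoherentMap {R : Type u} [CommRing R] {M N : Type u} [AddCommGroup M] [Module R M] [AddCommGroup N] [Module R N]
    (g : M →ₗ[R] N) : Hom (quasiCoherent R M) (quasiCoherent R N) where
  app A _ _ := g.baseChange A
  naturality {A B} _ _ _ _ φ x := by
    change g.baseChange B (LinearMap.rTensor M φ.toLinearMap x) =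
      LinearMap.rTensor N φ.toLinearMap (g.baseChange A x)
    induction x using TensorProduct.induction_on with
    | zero => simp
    | tmul b m => simp
    | add x y hx hy => rw [map_add, map_add, hx, hy, map_add, map_add]

/-- The `𝓡`-module scheme `𝓜^*` associated with an `R`-module `M`, the dual of `𝓜`:
`𝓜^*(A) = Hom_A(A ⊗[R] M, A)`. A morphism `φ : A → B` sends `w` to its base change along `φ`,
that is, to the `B`-linear map with `1 ⊗ m ↦ φ (w (1 ⊗ m))`. -/
noncomputable def dual (R : Type u) [CommRing R] (M : Type u) [AddCommGroup M] [Module R M] :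
    ModuleFunctor R where
  obj A _ _ := (A ⊗[R] M) →ₗ[A] A
  addCommGroup _ _ _ := inferInstance
  module _ _ _ := inferInstance
  map {A B} _ _ _ _ φ :=
    { toFun := fun w => LinearMap.liftBaseChange B
        (φ.toLinearMap ∘ₗ w.restrictScalars R ∘ₗ TensorProduct.mk R A M 1)
      map_zero' := by ext m; simp
      map_add' := fun w w' => by ext m; simp }
  map_smul φ a w := by ext m; simp
  map_id A _ _ w := by ext m; simp
  map_comp ψ φ w := by ext m; simp

/-- An `𝓡`-submodule of an `𝓡`-module. -/
@[ext]
structure Sub {R : Type u} [CommRing R] (X : ModuleFunctor R) where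
  /-- The value at a commutative `R`-algebra. -/
  carrier (A : Type u) [CommRing A] [Algebra R A] : Submodule A (X.obj A)
  map_mem {A B : Type u} [CommRing A] [Algebra R A] [CommRing B] [Algebra R B]
    (φ : A →ₐ[R] B) {x : X.obj A} (hx : x ∈ carrier A) : X.map φ x ∈ carrier B

namespace Sub

variable {R : Type u} [CommRing R] {X : ModuleFunctor R}

/-- Inclusion of `𝓡`-submodules: `S(A) ⊆ T(A)` for every commutative `R`-algebra `A`. -/
instance : PartialOrder (Sub X) where
  le S T := ∀ (A : Type u) [CommRing A] [Algebra R A], S.carrier A ≤ T.carrier A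
  le_refl S A _ _ := le_refl _
  le_trans S T U h h' A _ _ := (h A).trans (h' A)
  le_antisymm S T h h' := by
    ext A _ _ x
    exact ⟨fun hx => h A hx, fun hx => h' A hx⟩

/-- An `𝓡`-submodule, regarded as an `𝓡`-module. -/
def toModuleFunctor (S : Sub X) : ModuleFunctor R where
  obj A _ _ := S.carrier A
  addCommGroup _ _ _ := inferInstance
  module _ _ _ := inferInstance
  map φ := { toFun := fun x => ⟨X.map φ x.1, S.map_mem φ x.2⟩
             map_zero' := by ext; simp
             map_add' := fun x y => by ext; simp }
  map_smul φ a x := by ext; simp [X.map_smul]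
  map_id A _ _ x := by ext; simp [X.map_id]
  map_comp ψ φ x := by ext; simp [X.map_comp]

/-- The inclusion morphism of an `𝓡`-submodule. -/
def incl (S : Sub X) : Hom S.toModuleFunctor X where
  app A _ _ := (S.carrier A).subtype
  naturality _ _ := rfl

/-- `S` is an `𝓡`-submodule scheme associated with an `R`-module: it is isomorphic to `𝓦^*` for
some `R`-module `W` (a morphism of `𝓡`-modules is an isomorphism iff all its components are
bijective). -/
def IsModuleScheme (S : Sub X) : Prop :=
  ∃ (W : Type u) (_ : AddCommGroup W) (_ : Module R W)
    (e : Hom (dual R W) S.toModuleFunctor),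
    ∀ (A : Type u) [CommRing A] [Algebra R A], Function.Bijective (e.app A)

/-- The morphism `f : Y → X` factors through the `𝓡`-submodule `S` of `X`. -/
def Factors (S : Sub X) {Y : ModuleFunctor R} (f : Hom Y X) : Prop :=
  ∃ g : Hom Y S.toModuleFunctor, S.incl.comp g = f

end Sub

/-- Among the `𝓡`-submodule schemes `𝓦^* ⊆ X` (associated with `R`-modules `W`) through which `f`
factors there is a smallest one. -/
def HasSmallestSubmoduleScheme {R : Type u} [CommRing R] {Y X : ModuleFunctor R} (f : Hom Y X) : Prop :=
  ∃ S : Sub X, IsLeast {S : Sub X | S.IsModuleScheme ∧ S.Factors f} S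

end ModuleFunctor

/-- `M` is a flat Mittag-Leffler `R`-module: it is the direct limit of a direct system, indexed by
an upward directed set, of finite free modules `L i`, such that the inverse system of the duals
`(L i)^*` satisfies the Mittag-Leffler condition. -/
def IsFlatMittagLeffler (R : Type u) [CommRing R] (M : Type u) [AddCommGroup M] [Module R M] :
    Prop :=
  ∃ (ι : Type u) (_ : DecidableEq ι) (_ : Preorder ι) (_ : Nonempty ι) (_ : IsDirectedOrder ι)
    (L : ι → Type u) (_ : ∀ i, AddCommGroup (L i)) (_ : ∀ i, Module R (L i))
    (f : ∀ i j, i ≤ j → L i →ₗ[R] L j) (_ : DirectedSystem L (fun i j h => f i j h)),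
    (∀ i, Module.Free R (L i)) ∧ (∀ i, Module.Finite R (L i)) ∧
    Nonempty (Module.DirectLimit L f ≃ₗ[R] M) ∧
    ∀ i, ∃ j, ∃ hij : i ≤ j, ∀ k, ∀ hjk : j ≤ k,
      LinearMap.range (f i k (hij.trans hjk)).dualMap = LinearMap.range (f i j hij).dualMap

/-! Every statement is one about tensors. A morphism `𝓝^* → 𝓜` is the same as an element of `N ⊗ M`
(`exists_ofTensor_eq`, `ofTensor_injective`). It is injective iff the tensor is nondegenerate, and
one image contains another iff a linear map carries one tensor to the other
(`range_ofTensor_le_iff`). Submodule schemes of `𝓜` are thus the images of nondegenerate tensors,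
and (5) is (6) rewritten.

(1) ⇒ (6): let `M = lim L i` and let `x` come from `z ∈ N ⊗ L i`. Contraction with `z` maps `(L
i)^*` to `N`. Moving `z` to `L k` restricts this map to the image of `(L k)^*` in `(L i)^*`. These
images stabilise, and the contraction of the stable one is the least support.

(6) ⇒ (2): uniqueness of least pairs makes `M` flat; flatness makes the least tensor nondegenerate,
so it spans a submodule scheme, which is the smallest.

(3) ⇒ (4): a nondegenerate tensor over `x` is pushed onto its image in `R^n`.

(4) ⇒ (1): nondegeneracy gives the equational criterion, so `M` is flat and Lazard's theorem
provides the `L i`. Apply (4) to the tensor in `(L i)^* ⊗ M` of the map `L i → M`: the resulting `W`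
lies in every image of `(L k)^*` and contains one of them, so the images stabilise. -/

/-! ### Contraction of tensors with finite free modules -/

section Contraction

variable {R N N' L L' : Type*} [CommRing R] [AddCommGroup N] [Module R N]
  [AddCommGroup N'] [Module R N'] [AddCommGroup L] [Module R L] [AddCommGroup L'] [Module R L']

variable (R N L) in
/-- The contraction `N ⊗ L → Hom (L^*, N)`. -/
noncomputable def TensorProduct.contract : N ⊗[R] L →ₗ[R] Module.Dual R L →ₗ[R] N :=
  TensorProduct.lift (LinearMap.mk₂ R
    (fun n l => (LinearMap.toSpanSingleton R N n) ∘ₗ Module.Dual.eval R L l)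
    (by intros; ext; simp) (fun c n l => by ext a; simp [smul_comm c (a l) n])
    (by intros; ext; simp [add_smul]) (by intros; ext; simp [mul_smul]))

namespace TensorProduct

@[simp]
lemma contract_tmul (n : N) (l : L) (a : Module.Dual R L) :
    contract R N L (n ⊗ₜ l) a = a l • n := by
  simp [contract]

lemma contract_lTensor (f : L →ₗ[R] L') (z : N ⊗[R] L) :
    contract R N L' (f.lTensor N z) = contract R N L z ∘ₗ f.dualMap := by
  induction z with
  | zero => simp
  | tmul n l => ext a; simp
  | add x y hx hy => simp [hx, hy, LinearMap.add_comp]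

lemma contract_rTensor (g : N →ₗ[R] N') (z : N ⊗[R] L) :
    contract R N' L (g.rTensor L z) = g ∘ₗ contract R N L z := by
  induction z with
  | zero => simp
  | tmul n l => ext a; simp
  | add x y hx hy => simp [hx, hy, LinearMap.comp_add]

lemma sum_contract_coord_tmul {κ : Type*} [Fintype κ] [DecidableEq κ] (b : Module.Basis κ R L)
    (z : N ⊗[R] L) : ∑ k, contract R N L z (b.coord k) ⊗ₜ[R] b k = z := by
  induction z with
  | zero => simp
  | tmul n l =>
    simp only [contract_tmul, TensorProduct.smul_tmul, ← TensorProduct.tmul_sum]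
    congr 1
    exact b.sum_repr l
  | add x y hx hy =>
    simp only [map_add, LinearMap.add_apply, TensorProduct.add_tmul, Finset.sum_add_distrib, hx, hy]

/-- The coefficients of `z` in a basis of `L` are values of its contraction. -/
lemma exists_rTensor_subtype_eq [Module.Free R L] [Module.Finite R L] (P : Submodule R N)
    (z : N ⊗[R] L) (h : LinearMap.range (contract R N L z) ≤ P) :
    ∃ y : P ⊗[R] L, P.subtype.rTensor L y = z := by
  classical
  let b := Module.Free.chooseBasis R L
  refine ⟨∑ k, ⟨contract R N L z (b.coord k), h ⟨_, rfl⟩⟩ ⊗ₜ[R] b k, ?_⟩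
  rw [map_sum]
  simpa using sum_contract_coord_tmul b z

variable (R L) in
lemma exists_contract_eq_id [Module.Free R L] [Module.Finite R L] :
    ∃ z : Module.Dual R L ⊗[R] L, contract R _ L z = LinearMap.id := by
  classical
  let b := Module.Free.chooseBasis R L
  refine ⟨∑ k, b.coord k ⊗ₜ[R] b k, ?_⟩
  ext a l
  conv_rhs => rw [LinearMap.id_apply, ← b.sum_repr l, map_sum]
  simp only [map_sum, contract_tmul, LinearMap.sum_apply, LinearMap.smul_apply, map_smul,
    Module.Basis.coord_apply, smul_eq_mul, mul_comm]

end TensorProduct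

end Contraction

/-! ### Tensor products and direct limits -/

namespace Module.DirectLimit

open TensorProduct

lemma comp_of_directedSystem {R : Type*} [CommRing R] {ι : Type*} [Preorder ι]
    {L : ι → Type*} [∀ i, AddCommGroup (L i)] [∀ i, Module R (L i)] (f : ∀ i j, i ≤ j → L i →ₗ[R] L j)
    [DirectedSystem L (fun i j h => f i j h)] {i j k : ι} (hij : i ≤ j) (hjk : j ≤ k) :
    f j k hjk ∘ₗ f i j hij = f i k (hij.trans hjk) := by
  ext a
  exact DirectedSystem.map_map' f hij hjk a

variable {R : Type*} [CommRing R] {ι : Type*} [DecidableEq ι] [Preorder ι]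
  {L : ι → Type*} [∀ i, AddCommGroup (L i)] [∀ i, Module R (L i)]
  {f : ∀ i j, i ≤ j → L i →ₗ[R] L j}

lemma of_comp {i j : ι} (hij : i ≤ j) : of R ι L f j ∘ₗ f i j hij = of R ι L f i := by
  ext; simp

lemma exists_lTensor_of [Nonempty ι] [IsDirectedOrder ι] {N : Type*} [AddCommGroup N] [Module R N]
    (x : N ⊗[R] DirectLimit L f) : ∃ i, ∃ z : N ⊗[R] L i, (of R ι L f i).lTensor N z = x := by
  induction x with
  | zero => exact ⟨Classical.arbitrary ι, 0, by simp⟩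
  | tmul n m =>
    obtain ⟨i, l, rfl⟩ := exists_of m
    exact ⟨i, n ⊗ₜ l, by simp⟩
  | add x y hx hy =>
    obtain ⟨i, z, rfl⟩ := hx
    obtain ⟨j, w, rfl⟩ := hy
    obtain ⟨k, hik, hjk⟩ := exists_ge_ge i j
    refine ⟨k, (f i k hik).lTensor N z + (f j k hjk).lTensor N w, ?_⟩
    rw [map_add, ← LinearMap.lTensor_comp_apply, ← LinearMap.lTensor_comp_apply, of_comp, of_comp]

lemma directLimitRight_lTensor_of {N : Type*} [AddCommGroup N] [Module R N] {i : ι}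
    (z : N ⊗[R] L i) :
    directLimitRight f N ((of R ι L f i).lTensor N z) =
      of R ι (fun i => N ⊗[R] L i) (fun i j h => (f i j h).lTensor N) i z := by
  induction z with
  | zero => simp
  | tmul n l => simp
  | add x y hx hy => rw [map_add, map_add, hx, hy, map_add]

lemma exists_lTensor_eq_of_lTensor_of_eq [IsDirectedOrder ι] [DirectedSystem L (fun i j h => f i j h)]
    {N : Type*} [AddCommGroup N] [Module R N] {i : ι}
    {z w : N ⊗[R] L i} (h : (of R ι L f i).lTensor N z = (of R ι L f i).lTensor N w) :
    ∃ j, ∃ hij : i ≤ j, (f i j hij).lTensor N z = (f i j hij).lTensor N w := by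
  apply_fun directLimitRight f N at h
  rw [directLimitRight_lTensor_of, directLimitRight_lTensor_of] at h
  exact exists_eq_of_of_eq h

end Module.DirectLimit

lemma Module.Flat.directLimit {R : Type u} [CommRing R] {ι : Type*} [DecidableEq ι] [Preorder ι]
    [Nonempty ι] [IsDirectedOrder ι] {L : ι → Type*} [∀ i, AddCommGroup (L i)]
    [∀ i, Module R (L i)] (f : ∀ i j, i ≤ j → L i →ₗ[R] L j)
    [DirectedSystem L (fun i j h => f i j h)] [∀ i, Module.Flat R (L i)] :
    Module.Flat R (Module.DirectLimit L f) := by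
  rw [Module.Flat.iff_rTensor_preserves_injective_linearMap'.{u}]
  intro Q P _ _ _ _ g hg
  refine (injective_iff_map_eq_zero _).2 fun x hx => ?_
  obtain ⟨i, z, rfl⟩ := DirectLimit.exists_lTensor_of x
  rw [← LinearMap.comp_apply, LinearMap.rTensor_comp_lTensor, ← LinearMap.lTensor_comp_rTensor,
    LinearMap.comp_apply, ← map_zero ((DirectLimit.of R ι L f i).lTensor P)] at hx
  obtain ⟨j, hij, h⟩ := DirectLimit.exists_lTensor_eq_of_lTensor_of_eq hx
  rw [map_zero, ← LinearMap.comp_apply, LinearMap.lTensor_comp_rTensor,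
    ← LinearMap.rTensor_comp_lTensor, LinearMap.comp_apply] at h
  have := Module.Flat.rTensor_preserves_injective_linearMap (M := L j) g hg
    (h.trans (map_zero _).symm)
  rw [← DirectLimit.of_comp hij, LinearMap.lTensor_comp_apply, this, map_zero]

/-! ### Lazard's theorem -/

/-- Linear maps from a standard finite free module to `M`, the objects of the category of finite
free modules over `M`. -/
structure FiniteFreeOver (R : Type u) [CommRing R] (M : Type u) [AddCommGroup M] [Module R M] where
  /-- The rank of the source. -/
  rank : ℕ
  /-- The structure morphism. -/
  toLinearMap : (Fin rank →₀ R) →ₗ[R] M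

namespace FiniteFreeOver

open CategoryTheory

variable {R : Type u} [CommRing R] {M : Type u} [AddCommGroup M] [Module R M]

noncomputable instance : SmallCategory (FiniteFreeOver R M) where
  Hom X Y := {a : (Fin X.rank →₀ R) →ₗ[R] (Fin Y.rank →₀ R) //
    Y.toLinearMap ∘ₗ a = X.toLinearMap}
  id X := ⟨LinearMap.id, rfl⟩
  comp a b := ⟨b.1 ∘ₗ a.1, by rw [← LinearMap.comp_assoc, b.2, a.2]⟩

lemma exists_linearEquiv_comp_eq {L : Type*} [AddCommGroup L] [Module R L] [Module.Free R L]
    [Module.Finite R L] (v : L →ₗ[R] M) :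
    ∃ (X : FiniteFreeOver R M) (e : L ≃ₗ[R] (Fin X.rank →₀ R)),
      X.toLinearMap ∘ₗ e.toLinearMap = v := by
  let e := ((Module.Free.chooseBasis R L).reindex (Fintype.equivFin _)).repr
  refine ⟨⟨Fintype.card _, v ∘ₗ e.symm.toLinearMap⟩, e, ?_⟩
  ext; simp

/-- Pairs of objects are bounded by direct sums. Flatness serves to coequalise parallel arrows:
their difference dies in `M`, so by the equational criterion it already dies in some finite free
module over `M`. -/
instance [Module.Flat R M] : IsFiltered (FiniteFreeOver R M) where
  nonempty := ⟨⟨0, 0⟩⟩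
  cocone_objs X Y := by
    obtain ⟨Z, e, he⟩ := exists_linearEquiv_comp_eq (X.toLinearMap.coprod Y.toLinearMap)
    refine ⟨Z, ⟨e.toLinearMap ∘ₗ LinearMap.inl R _ _, ?_⟩, ⟨e.toLinearMap ∘ₗ LinearMap.inr R _ _, ?_⟩, trivial⟩
    · rw [← LinearMap.comp_assoc, he, LinearMap.coprod_inl]
    · rw [← LinearMap.comp_assoc, he, LinearMap.coprod_inr]
  cocone_maps X Y a b := by
    obtain ⟨k, c, y, hy, hc⟩ := Module.Flat.exists_factorization_of_comp_eq_zero_of_free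
      (f := a.1 - b.1) (x := Y.toLinearMap) (by rw [LinearMap.comp_sub, a.2, b.2, sub_self])
    refine ⟨⟨k, y⟩, ⟨c, hy.symm⟩, Subtype.ext ?_⟩
    exact sub_eq_zero.1 ((LinearMap.comp_sub _ _ _).symm.trans hc)

end FiniteFreeOver

open CategoryTheory in
/-- **Lazard's theorem**: a flat module is the direct limit of finite free modules. -/
theorem Module.Flat.exists_directLimit_equiv (R : Type u) [CommRing R] (M : Type u)
    [AddCommGroup M] [Module R M] [Module.Flat R M] :
    ∃ (ι : Type u) (_ : DecidableEq ι) (_ : Preorder ι) (_ : Nonempty ι) (_ : IsDirectedOrder ι)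
      (L : ι → Type u) (_ : ∀ i, AddCommGroup (L i)) (_ : ∀ i, Module R (L i))
      (f : ∀ i j, i ≤ j → L i →ₗ[R] L j) (_ : DirectedSystem L (fun i j h => f i j h)),
      (∀ i, Module.Free R (L i)) ∧ (∀ i, Module.Finite R (L i)) ∧
      Nonempty (Module.DirectLimit L f ≃ₗ[R] M) := by
  classical
  obtain ⟨ι, _, _, _, F, _⟩ := IsFiltered.exists_directed (FiniteFreeOver R M)
  obtain ⟨hex, hcoeq⟩ := (Functor.final_iff_of_isFiltered F).1 inferInstance
  let f : ∀ i j : ι, i ≤ j → (Fin (F.obj i).rank →₀ R) →ₗ[R] (Fin (F.obj j).rank →₀ R) :=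
    fun i j h => (F.map (homOfLE h)).1
  have hf : ∀ i j (h : i ≤ j), (F.obj j).toLinearMap ∘ₗ f i j h = (F.obj i).toLinearMap :=
    fun i j h => (F.map (homOfLE h)).2
  let φ : Module.DirectLimit (fun i => Fin (F.obj i).rank →₀ R) f →ₗ[R] M :=
    Module.DirectLimit.lift R ι _ f (fun i => (F.obj i).toLinearMap)
      (fun i j h x => LinearMap.congr_fun (hf i j h) x)
  refine ⟨ι, inferInstance, inferInstance, inferInstance, inferInstance,
    fun i => Fin (F.obj i).rank →₀ R, inferInstance, inferInstance, f, ⟨?_, ?_⟩,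
    fun i => inferInstance, fun i => inferInstance, ⟨LinearEquiv.ofBijective φ ⟨?_, ?_⟩⟩⟩
  · intro i x
    exact LinearMap.congr_fun (congrArg Subtype.val (F.map_id i)) x
  · intro k j i hij hjk x
    exact (LinearMap.congr_fun
      (congrArg Subtype.val (F.map_comp (homOfLE hij) (homOfLE hjk))) x).symm
  · intro z w hzw
    obtain ⟨i, x, x', rfl, rfl⟩ := Module.DirectLimit.exists_of₂ z w
    rw [Module.DirectLimit.lift_of, Module.DirectLimit.lift_of, ← sub_eq_zero, ← map_sub] at hzw
    -- The difference dies in some `Y` over `M`. By finality `Y` maps to a stage of the system, and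
    -- further on the route through `Y` agrees with the transition map.
    obtain ⟨k, a, y, hy, ha⟩ := Module.Flat.exists_factorization_of_apply_eq_zero_of_free hzw
    let Y : FiniteFreeOver R M := ⟨k, y⟩
    let α : F.obj i ⟶ Y := ⟨a, hy.symm⟩
    obtain ⟨j, ⟨β⟩⟩ := hex Y
    obtain ⟨l, hil, hjl⟩ := exists_ge_ge i j
    obtain ⟨m, t, ht⟩ := hcoeq (F.map (homOfLE hil)) (α ≫ β ≫ F.map (homOfLE hjl))
    rw [← F.map_comp] at ht
    have him : f i m (hil.trans (leOfHom t)) (x - x') = 0 := by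
      refine (LinearMap.congr_fun (congrArg Subtype.val ht) (x - x')).trans ?_
      change (F.map t).1 ((F.map (homOfLE hjl)).1 (β.1 (a (x - x')))) = 0
      rw [ha, map_zero, map_zero, map_zero]
    rw [map_sub, sub_eq_zero] at him
    rw [← Module.DirectLimit.of_f (hij := hil.trans (leOfHom t)), him, Module.DirectLimit.of_f]
  · intro m
    let X : FiniteFreeOver R M := ⟨1, Finsupp.linearCombination R (fun _ => m)⟩
    obtain ⟨i, ⟨β⟩⟩ := hex X
    refine ⟨Module.DirectLimit.of R ι _ f i (β.1 (Finsupp.single 0 1)), ?_⟩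
    rw [Module.DirectLimit.lift_of]
    refine (LinearMap.congr_fun β.2 (Finsupp.single 0 1)).trans ?_
    simp [X]

/-! ### Morphisms from module schemes to quasi-coherent modules -/

/-- An element of `N ⊗ M` is nondegenerate if no nonzero linear map out of `N` kills it. -/
def TensorProduct.IsNondegenerate {R : Type u} [CommRing R] {N M : Type u} [AddCommGroup N]
    [Module R N] [AddCommGroup M] [Module R M] (x : N ⊗[R] M) : Prop :=
  ∀ (V : Type u) [AddCommGroup V] [Module R V] (φ : N →ₗ[R] V), φ.rTensor M x = 0 → φ = 0

namespace ModuleFunctor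

section DualToQuasiCoherent

variable {R : Type u} [CommRing R] {N M : Type u} [AddCommGroup N] [Module R N]
  [AddCommGroup M] [Module R M]

/-- The restriction to `N` of an `A`-linear form on `A ⊗ N`. -/
def dualRestrict {A : Type u} [CommRing A] [Algebra R A] (w : (dual R N).obj A) : N →ₗ[R] A :=
  LinearMap.restrictScalars R (S := A) (M := A ⊗[R] N) w ∘ₗ TensorProduct.mk R A N 1

/-- The `A`-linear extension to `A ⊗ N` of a linear map `N → A`. -/
noncomputable def dualExtend {A : Type u} [CommRing A] [Algebra R A] (v : N →ₗ[R] A) :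
    (dual R N).obj A :=
  LinearMap.liftBaseChange A v

variable {A B : Type u} [CommRing A] [Algebra R A] [CommRing B] [Algebra R B]

@[simp]
lemma dualRestrict_dualExtend (v : N →ₗ[R] A) : dualRestrict (dualExtend v) = v := by
  ext n
  exact (LinearMap.liftBaseChange_tmul ..).trans (one_smul A (v n))

@[simp]
lemma dualExtend_dualRestrict (w : (dual R N).obj A) : dualExtend (dualRestrict w) = w := by
  refine TensorProduct.AlgebraTensorModule.ext fun a n => ?_
  refine (LinearMap.liftBaseChange_tmul ..).trans ?_
  refine (LinearMap.map_smul (M := A ⊗[R] N) (M₂ := A) w a (1 ⊗ₜ n)).symm.trans ?_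
  rw [TensorProduct.smul_tmul', smul_eq_mul, mul_one]

lemma dual_map_eq (φ : A →ₐ[R] B) (w : (dual R N).obj A) :
    (dual R N).map φ w = dualExtend (φ.toLinearMap ∘ₗ dualRestrict w) := rfl

lemma dualRestrict_add (w w' : (dual R N).obj A) :
    dualRestrict (w + w') = dualRestrict w + dualRestrict w' := rfl

lemma dualRestrict_smul_apply (a : A) (w : (dual R N).obj A) (n : N) :
    dualRestrict (a • w) n = a * dualRestrict w n := rfl

lemma dualRestrict_zero : dualRestrict (0 : (dual R N).obj A) = 0 := rfl

lemma dualRestrict_injective : Function.Injective (dualRestrict : (dual R N).obj A → _) :=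
  Function.LeftInverse.injective dualExtend_dualRestrict

/-- The morphism `𝓝^* → 𝓜` given by contraction with an element of `N ⊗ M`. -/
noncomputable def ofTensor (x : N ⊗[R] M) : Hom (dual R N) (quasiCoherent R M) where
  app A _ _ :=
    { toFun w := (dualRestrict w).rTensor M x
      map_add' w w' := by
        rw [dualRestrict_add, LinearMap.rTensor_add]; rfl
      map_smul' a w := by
        change (dualRestrict (a • w)).rTensor M x = a • (dualRestrict w).rTensor M x
        induction x with
        | zero => simp
        | tmul n m => simp [dualRestrict_smul_apply, TensorProduct.smul_tmul']
        | add x y hx hy => rw [map_add, map_add, hx, hy, smul_add] }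
  naturality φ w := by
    change (dualRestrict ((dual R N).map φ w)).rTensor M x =
      φ.toLinearMap.rTensor M ((dualRestrict w).rTensor M x)
    rw [dual_map_eq, dualRestrict_dualExtend, LinearMap.rTensor_comp_apply]

lemma ofTensor_app (x : N ⊗[R] M) (w : (dual R N).obj A) :
    (ofTensor x).app A w = (dualRestrict w).rTensor M x := rfl

lemma ofTensor_app_dualExtend (x : N ⊗[R] M) (v : N →ₗ[R] A) :
    (ofTensor x).app A (dualExtend v) = v.rTensor M x := by
  rw [ofTensor_app, dualRestrict_dualExtend]

lemma Hom.app_dualExtend_comp (f : Hom (dual R N) (quasiCoherent R M)) (φ : A →ₐ[R] B)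
    (v : N →ₗ[R] A) : f.app B (dualExtend (φ.toLinearMap ∘ₗ v)) =
      φ.toLinearMap.rTensor M (f.app A (dualExtend v)) := by
  rw [← dualRestrict_dualExtend v, ← dual_map_eq, dualRestrict_dualExtend]
  exact f.naturality φ _

section TrivSqZeroExt

variable [Module Rᵐᵒᵖ N] [IsCentralScalar R N]

lemma rTensor_snd_eps_smul (y : A ⊗[R] M) :
    ((TrivSqZeroExt.sndHom A A).restrictScalars R).rTensor M
      ((DualNumber.eps : DualNumber A) •
        (TrivSqZeroExt.inlAlgHom R A A).toLinearMap.rTensor M y) = y := by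
  induction y with
  | zero => simp
  | tmul a m => simp [TensorProduct.smul_tmul']
  | add x y hx hy => rw [map_add, smul_add, map_add, hx, hy]

/-- The inclusion of `N` in `R ⊕ N` (square zero) is a universal point. For `v : N → A`, the algebra
map `r + n ↦ r + v(n) ε` into `A[ε]` sends it to `ε v`. Naturality and `A[ε]`-linearity then
determine `ε f(v)`, and its `ε`-coefficient is `f(v)`. -/
lemma exists_ofTensor_eq_aux (f : Hom (dual R N) (quasiCoherent R M)) :
    ofTensor ((TrivSqZeroExt.sndHom R N).rTensor M
      (f.app (TrivSqZeroExt R N) (dualExtend (TrivSqZeroExt.inrHom R N)))) = f := by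
  ext A _ _ w
  obtain ⟨v, rfl⟩ : ∃ v : N →ₗ[R] A, dualExtend v = w := ⟨_, dualExtend_dualRestrict w⟩
  let inrA : A →ₗ[R] DualNumber A := (TrivSqZeroExt.inrHom A A).restrictScalars R
  let ψ : TrivSqZeroExt R N →ₐ[R] DualNumber A := TrivSqZeroExt.liftEquivOfComm
    ⟨inrA ∘ₗ v, fun x y => TrivSqZeroExt.inr_mul_inr ..⟩
  have hψ : ψ.toLinearMap ∘ₗ TrivSqZeroExt.inrHom R N = inrA ∘ₗ v := by
    ext n <;> simp [ψ]
  have hψ' : (TrivSqZeroExt.sndHom A A).restrictScalars R ∘ₗ ψ.toLinearMap =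
      v ∘ₗ TrivSqZeroExt.sndHom R N := by
    apply TrivSqZeroExt.linearMap_ext
    · intro r
      simp [ψ, inrA, Algebra.ofId_apply, TrivSqZeroExt.algebraMap_eq_inl']
    · intro n
      simp [ψ, inrA]
  have heps : dualExtend (inrA ∘ₗ v) = (DualNumber.eps : DualNumber A) •
      dualExtend ((TrivSqZeroExt.inlAlgHom R A A).toLinearMap ∘ₗ v) := by
    apply dualRestrict_injective
    ext n <;> simp [dualRestrict_smul_apply, inrA]
  have h := f.app_dualExtend_comp ψ (TrivSqZeroExt.inrHom R N)
  rw [hψ, heps, LinearMap.map_smul, f.app_dualExtend_comp] at h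
  have h' := congrArg (((TrivSqZeroExt.sndHom A A).restrictScalars R).rTensor M) h
  have hsnd (G : TrivSqZeroExt R N ⊗[R] M) :
      ((TrivSqZeroExt.sndHom A A).restrictScalars R).rTensor M (ψ.toLinearMap.rTensor M G) =
        v.rTensor M ((TrivSqZeroExt.sndHom R N).rTensor M G) := by
    rw [← LinearMap.rTensor_comp_apply, hψ', LinearMap.rTensor_comp_apply]
  rw [ofTensor_app_dualExtend]
  exact ((rTensor_snd_eps_smul _).symm.trans (h'.trans (hsnd _))).symm

end TrivSqZeroExt

lemma exists_ofTensor_eq (f : Hom (dual R N) (quasiCoherent R M)) : ∃ x, ofTensor x = f := by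
  let : Module Rᵐᵒᵖ N := Module.compHom N ((RingHom.id R).fromOpposite mul_comm)
  have : IsCentralScalar R N := ⟨fun _ _ => rfl⟩
  exact ⟨_, exists_ofTensor_eq_aux f⟩

/-- Each module is a linear retract of an algebra, so values on algebras suffice to test statements
about all modules. -/
lemma exists_injective_algebra (R : Type u) [CommRing R] (V : Type u) [AddCommGroup V]
    [Module R V] : ∃ (A : Type u) (_ : CommRing A) (_ : Algebra R A) (i : V →ₗ[R] A)
      (p : A →ₗ[R] V), p ∘ₗ i = LinearMap.id := by
  let : Module Rᵐᵒᵖ V := Module.compHom V ((RingHom.id R).fromOpposite mul_comm)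
  have : IsCentralScalar R V := ⟨fun _ _ => rfl⟩
  exact ⟨TrivSqZeroExt R V, inferInstance, inferInstance, TrivSqZeroExt.inrHom R V,
    TrivSqZeroExt.sndHom R V, rfl⟩

lemma ofTensor_injective : Function.Injective (ofTensor : N ⊗[R] M → _) := by
  intro x y h
  obtain ⟨A, _, _, i, p, hp⟩ := exists_injective_algebra R N
  have h' : (ofTensor x).app A (dualExtend i) = (ofTensor y).app A (dualExtend i) := by rw [h]
  rw [ofTensor_app_dualExtend, ofTensor_app_dualExtend] at h'
  simpa only [← LinearMap.rTensor_comp_apply, hp, LinearMap.rTensor_id_apply] using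
    congrArg (p.rTensor M) h'

lemma quasiCoherentMap_comp_ofTensor {M' : Type u} [AddCommGroup M'] [Module R M']
    (g : M →ₗ[R] M') (x : N ⊗[R] M) :
    (quasiCoherentMap g).comp (ofTensor x) = ofTensor (g.lTensor N x) := by
  ext A _ _ w
  change g.lTensor A ((dualRestrict w).rTensor M x) = (dualRestrict w).rTensor M' (g.lTensor N x)
  rw [← LinearMap.comp_apply, ← LinearMap.comp_apply, LinearMap.lTensor_comp_rTensor,
    LinearMap.rTensor_comp_lTensor]

lemma forall_injective_ofTensor_iff (x : N ⊗[R] M) :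
    (∀ (A : Type u) [CommRing A] [Algebra R A], Function.Injective ((ofTensor x).app A)) ↔
      x.IsNondegenerate := by
  refine ⟨fun h V _ _ φ hφ => ?_, fun h A _ _ => (injective_iff_map_eq_zero _).2 fun w hw => ?_⟩
  · obtain ⟨A, _, _, i, p, hp⟩ := exists_injective_algebra R V
    have h0 : (ofTensor x).app A (dualExtend (i ∘ₗ φ)) = (ofTensor x).app A 0 := by
      rw [map_zero, ofTensor_app_dualExtend, LinearMap.rTensor_comp_apply, hφ, map_zero]
      rfl
    have h1 : i ∘ₗ φ = 0 := by
      rw [← dualRestrict_dualExtend (i ∘ₗ φ), h A h0, dualRestrict_zero]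
    rw [← LinearMap.id_comp φ, ← hp, LinearMap.comp_assoc, h1, LinearMap.comp_zero]
  · exact dualRestrict_injective (h A _ hw)

end DualToQuasiCoherent

/-! ### Submodule schemes as images of morphisms -/

section Subfunctors

variable {R : Type u} [CommRing R]

/-- The image of a morphism of `𝓡`-modules. -/
def Hom.range {X Y : ModuleFunctor R} (f : Hom Y X) : Sub X where
  carrier A _ _ := LinearMap.range (f.app A)
  map_mem φ := by
    rintro _ ⟨y, rfl⟩
    exact ⟨Y.map φ y, f.naturality φ y⟩

lemma Hom.isModuleScheme_range {X : ModuleFunctor R} {W : Type u} [AddCommGroup W] [Module R W]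
    (f : Hom (dual R W) X)
    (hf : ∀ (A : Type u) [CommRing A] [Algebra R A], Function.Injective (f.app A)) :
    f.range.IsModuleScheme :=
  ⟨W, inferInstance, inferInstance,
    { app A _ _ := (f.app A).rangeRestrict
      naturality φ x := Subtype.ext (f.naturality φ x) },
    fun A _ _ => ⟨fun _ _ h => hf A (congrArg Subtype.val h),
      (f.app A).surjective_rangeRestrict⟩⟩

lemma Sub.IsModuleScheme.exists_eq_range {X : ModuleFunctor R} {S : Sub X}
    (hS : S.IsModuleScheme) :
    ∃ (W : Type u) (_ : AddCommGroup W) (_ : Module R W) (f : Hom (dual R W) X),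
      (∀ (A : Type u) [CommRing A] [Algebra R A], Function.Injective (f.app A)) ∧
      f.range = S := by
  obtain ⟨W, _, _, e, he⟩ := hS
  refine ⟨W, inferInstance, inferInstance, S.incl.comp e,
    fun A _ _ x y h => (he A).1 (Subtype.ext h), ?_⟩
  ext A _ _ x
  constructor
  · rintro ⟨y, rfl⟩
    exact (e.app A y).2
  · intro hx
    obtain ⟨y, hy⟩ := (he A).2 ⟨x, hx⟩
    exact ⟨y, congrArg Subtype.val hy⟩

lemma Sub.factors_iff {X Y : ModuleFunctor R} {S : Sub X} {f : Hom Y X} :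
    S.Factors f ↔ f.range ≤ S := by
  constructor
  · rintro ⟨g, rfl⟩ A _ _ _ ⟨y, rfl⟩
    exact (g.app A y).2
  · intro h
    exact ⟨{ app A _ _ := (f.app A).codRestrict (S.carrier A) fun y => h A ⟨y, rfl⟩
             naturality φ x := Subtype.ext (f.naturality φ x) }, rfl⟩

lemma Hom.range_comp {X Y Z : ModuleFunctor R} (f : Hom Y X) (g : Hom Z Y)
    (hg : ∀ (A : Type u) [CommRing A] [Algebra R A], Function.Surjective (g.app A)) :
    (f.comp g).range = f.range := by
  ext A _ _ x
  constructor
  · rintro ⟨z, rfl⟩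
    exact ⟨g.app A z, rfl⟩
  · rintro ⟨y, rfl⟩
    obtain ⟨z, rfl⟩ := hg A y
    exact ⟨z, rfl⟩

variable {N W M : Type u} [AddCommGroup N] [Module R N] [AddCommGroup W] [Module R W]
  [AddCommGroup M] [Module R M]

lemma range_ofTensor_le_iff (x : N ⊗[R] M) (y : W ⊗[R] M) :
    (ofTensor x).range ≤ (ofTensor y).range ↔ ∃ θ : W →ₗ[R] N, θ.rTensor M y = x := by
  constructor
  · intro h
    -- The point `i : N → A` has value `x` up to the retraction `p`; a preimage of it under `y`,
    -- followed by `p`, is the required map.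
    obtain ⟨A, _, _, i, p, hp⟩ := exists_injective_algebra R N
    obtain ⟨w, hw⟩ := h A ⟨dualExtend i, rfl⟩
    refine ⟨p ∘ₗ dualRestrict w, ?_⟩
    rw [ofTensor_app, ofTensor_app_dualExtend] at hw
    rw [LinearMap.rTensor_comp_apply, hw, ← LinearMap.rTensor_comp_apply, hp,
      LinearMap.rTensor_id_apply]
  · rintro ⟨θ, rfl⟩ A _ _ _ ⟨w, rfl⟩
    refine ⟨dualExtend (dualRestrict w ∘ₗ θ), ?_⟩
    rw [ofTensor_app_dualExtend, LinearMap.rTensor_comp_apply]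
    rfl

variable (R) in
/-- The isomorphism from the dual of `R ^ n` to `𝓡ⁿ`. -/
noncomputable def dualToPower (n : ℕ) : Hom (dual R (Fin n → R)) (power R n) where
  app A _ _ :=
    { toFun w i := dualRestrict w (Pi.single i 1)
      map_add' _ _ := rfl
      map_smul' _ _ := rfl }
  naturality φ w := by
    funext i
    change dualRestrict ((dual R (Fin n → R)).map φ w) (Pi.single i 1) =
      φ (dualRestrict w (Pi.single i 1))
    rw [dual_map_eq, dualRestrict_dualExtend]
    rfl

lemma dualToPower_bijective (n : ℕ) (A : Type u) [CommRing A] [Algebra R A] :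
    Function.Bijective ((dualToPower R n).app A) := by
  constructor
  · intro w w' h
    refine dualRestrict_injective ((Pi.basisFun R (Fin n)).ext fun i => ?_)
    rw [Pi.basisFun_apply]
    exact congrFun h i
  · intro a
    refine ⟨dualExtend (Fintype.linearCombination R a), ?_⟩
    funext i
    change dualRestrict (dualExtend (Fintype.linearCombination R a)) (Pi.single i 1) = a i
    rw [dualRestrict_dualExtend]
    exact (Fintype.linearCombination_apply_single R a i 1).trans (one_smul R (a i))

/-- The inverse of a morphism of `𝓡`-modules with bijective components. -/
noncomputable def Hom.inverse {X Y : ModuleFunctor R} (f : Hom X Y)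
    (hf : ∀ (A : Type u) [CommRing A] [Algebra R A], Function.Bijective (f.app A)) : Hom Y X where
  app A _ _ := (LinearEquiv.ofBijective (f.app A) (hf A)).symm
  naturality {A B} _ _ _ _ φ y := by
    obtain ⟨x, rfl⟩ := (hf A).2 y
    rw [← f.naturality]
    change (LinearEquiv.ofBijective (f.app B) (hf B)).symm
      (LinearEquiv.ofBijective (f.app B) (hf B) _) = X.map φ
        ((LinearEquiv.ofBijective (f.app A) (hf A)).symm
          (LinearEquiv.ofBijective (f.app A) (hf A) _))
    simp

lemma Hom.inverse_surjective {X Y : ModuleFunctor R} (f : Hom X Y)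
    (hf : ∀ (A : Type u) [CommRing A] [Algebra R A], Function.Bijective (f.app A))
    (A : Type u) [CommRing A] [Algebra R A] : Function.Surjective ((f.inverse hf).app A) :=
  (LinearEquiv.ofBijective (f.app A) (hf A)).symm.surjective

end Subfunctors

end ModuleFunctor

/-! ### Least supports, nondegeneracy and flatness -/

namespace TensorProduct

variable {R : Type u} [CommRing R] {N M : Type u} [AddCommGroup N] [Module R N]
  [AddCommGroup M] [Module R M]

/-- Among the pairs `(N', x')` of a submodule of `N` and an element of `N' ⊗ M` lying over `x`
there is a smallest one. -/
def HasLeastSupport (x : N ⊗[R] M) : Prop :=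
  ∃ (N' : Submodule R N) (x' : N' ⊗[R] M), N'.subtype.rTensor M x' = x ∧
    ∀ (N'' : Submodule R N) (x'' : N'' ⊗[R] M), N''.subtype.rTensor M x'' = x →
      ∃ h : N' ≤ N'', (Submodule.inclusion h).rTensor M x' = x''

lemma rTensor_lTensor_comm {N₁ N₂ M₁ M₂ : Type u} [AddCommGroup N₁] [Module R N₁]
    [AddCommGroup N₂] [Module R N₂] [AddCommGroup M₁] [Module R M₁] [AddCommGroup M₂]
    [Module R M₂] (g : N₁ →ₗ[R] N₂) (a : M₁ →ₗ[R] M₂) (y : N₁ ⊗[R] M₁) :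
    g.rTensor M₂ (a.lTensor N₁ y) = a.lTensor N₂ (g.rTensor M₁ y) := by
  rw [← LinearMap.comp_apply, ← LinearMap.comp_apply, LinearMap.rTensor_comp_lTensor,
    LinearMap.lTensor_comp_rTensor]

lemma rTensor_mkQ_eq_zero_iff (P : Submodule R N) (x : N ⊗[R] M) :
    P.mkQ.rTensor M x = 0 ↔ ∃ y : P ⊗[R] M, P.subtype.rTensor M y = x :=
  rTensor_exact M (LinearMap.exact_subtype_mkQ P) P.mkQ_surjective x

/-- The composite of `θ` with `N → N/P` kills `y`, hence vanishes. -/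
lemma IsNondegenerate.range_le {W : Type u} [AddCommGroup W] [Module R W] {y : W ⊗[R] M}
    (hy : y.IsNondegenerate) (θ : W →ₗ[R] N) (P : Submodule R N) (z : P ⊗[R] M)
    (h : P.subtype.rTensor M z = θ.rTensor M y) : LinearMap.range θ ≤ P := by
  have := hy _ (P.mkQ ∘ₗ θ) (by
    rw [LinearMap.rTensor_comp_apply, rTensor_mkQ_eq_zero_iff]
    exact ⟨z, h⟩)
  rwa [← LinearMap.range_le_ker_iff, Submodule.ker_mkQ] at this

lemma IsNondegenerate.rTensor_surjective {W : Type u} [AddCommGroup W] [Module R W]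
    {y : W ⊗[R] M} (hy : y.IsNondegenerate) {θ : W →ₗ[R] N} (hθ : Function.Surjective θ) :
    (θ.rTensor M y).IsNondegenerate := by
  intro V _ _ φ hφ
  rw [← LinearMap.rTensor_comp_apply] at hφ
  rw [← LinearMap.cancel_right hθ, hy V _ hφ, LinearMap.zero_comp]

/-- Two elements of `Q ⊗ M` with the same image in `P ⊗ M` are both the image of the least pair,
hence equal. -/
lemma flat_of_forall_hasLeastSupport
    (h : ∀ (N : Type u) [AddCommGroup N] [Module R N] (x : N ⊗[R] M), x.HasLeastSupport) :
    Module.Flat R M := by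
  rw [Module.Flat.iff_rTensor_injectiveₛ]
  intro P _ _ Q
  let : AddCommGroup P := Module.addCommMonoidToAddCommGroup R
  intro y y' hyy'
  obtain ⟨P', x', -, hmin⟩ := h P (Q.subtype.rTensor M y)
  obtain ⟨h₁, rfl⟩ := hmin Q y rfl
  obtain ⟨h₂, rfl⟩ := hmin Q y' hyy'.symm
  rfl

/-- By flatness, a tensor killed by `φ` comes from `ker φ ⊗ M`; minimality then forces `ker φ` to be
all of `N'`. -/
lemma isNondegenerate_of_least [Module.Flat R M] {N' : Submodule R N} {x' : N' ⊗[R] M}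
    (h : ∀ (N'' : Submodule R N) (x'' : N'' ⊗[R] M),
      N''.subtype.rTensor M x'' = N'.subtype.rTensor M x' → N' ≤ N'') :
    x'.IsNondegenerate := by
  intro V _ _ φ hφ
  obtain ⟨y, rfl⟩ := (Module.Flat.rTensor_exact M (LinearMap.exact_subtype_ker_map φ) x').1 hφ
  have hle := h _ ((N'.subtype.submoduleMap (LinearMap.ker φ)).rTensor M y) (by
    rw [← LinearMap.rTensor_comp_apply, ← LinearMap.rTensor_comp_apply]
    rfl)
  ext n
  obtain ⟨k, hk, hkn⟩ := hle n.2
  rwa [← Subtype.ext hkn]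

lemma flat_of_forall_exists_isNondegenerate
    (h : ∀ (n : ℕ) (x : (Fin n → R) ⊗[R] M), ∃ (W : Submodule R (Fin n → R)) (x' : W ⊗[R] M),
      x'.IsNondegenerate ∧ W.subtype.rTensor M x' = x) : Module.Flat R M := by
  refine Module.Flat.of_forall_isTrivialRelation fun {n a m} ham => ?_
  -- The relation says that the functional with coefficients `a` kills this tensor, so it vanishes
  -- on `W`. Expanding `y` as a sum of pure tensors then trivialises the relation.
  obtain ⟨W, y, hy, hyx⟩ := h n (∑ i, Pi.single i 1 ⊗ₜ[R] m i)
  let ev : (Fin n → R) →ₗ[R] R := Fintype.linearCombination R a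
  have hev : ev ∘ₗ W.subtype = 0 := by
    refine hy _ _ ((TensorProduct.lid R M).injective ?_)
    rw [LinearMap.rTensor_comp_apply, hyx]
    simpa [ev, Fintype.linearCombination_apply_single] using ham
  obtain ⟨k, w, z, rfl⟩ := TensorProduct.exists_sum_tmul_eq y
  refine ⟨k, fun i j => (w j : Fin n → R) i, z, fun i => ?_, fun j => ?_⟩
  · have := congrArg (TensorProduct.lid R M ∘ (LinearMap.proj i : (Fin n → R) →ₗ[R] R).rTensor M)
      hyx
    simpa [Pi.single_apply, eq_comm] using this.symm
  · simpa [ev, Fintype.linearCombination_apply, mul_comm] using LinearMap.congr_fun hev (w j)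

end TensorProduct

/-! ### The Mittag-Leffler condition -/

section MittagLeffler

open TensorProduct Module.DirectLimit

variable {R : Type u} [CommRing R] {M : Type u} [AddCommGroup M] [Module R M]

lemma exists_rTensor_subtype_eq_lTensor {N L M : Type u} [AddCommGroup N] [Module R N]
    [AddCommGroup L] [Module R L] [AddCommGroup M] [Module R M] [Module.Free R L]
    [Module.Finite R L] (P : Submodule R N) (z : N ⊗[R] L) (g : L →ₗ[R] M)
    (h : LinearMap.range (contract R N L z) ≤ P) :
    ∃ y : P ⊗[R] M, P.subtype.rTensor M y = g.lTensor N z := by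
  obtain ⟨y, rfl⟩ := exists_rTensor_subtype_eq P z h
  exact ⟨g.lTensor P y, rTensor_lTensor_comm ..⟩

lemma range_contract_rTensor_le {W N L : Type u} [AddCommGroup N] [Module R N]
    [AddCommGroup L] [Module R L] [AddCommGroup W] [Module R W] (θ : W →ₗ[R] N) (y : W ⊗[R] L) :
    LinearMap.range (contract R N L (θ.rTensor L y)) ≤ LinearMap.range θ := by
  rw [contract_rTensor]
  exact LinearMap.range_comp_le_range _ _

lemma TensorProduct.HasLeastSupport.of_linearEquiv {N M' : Type u} [AddCommGroup M'] [Module R M']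
    [AddCommGroup N] [Module R N] (e : M ≃ₗ[R] M') {x : N ⊗[R] M} (h : x.HasLeastSupport) :
    (e.toLinearMap.lTensor N x).HasLeastSupport := by
  obtain ⟨N', x', rfl, hmin⟩ := h
  refine ⟨N', e.toLinearMap.lTensor N' x', rTensor_lTensor_comm .., fun N'' x'' hx'' => ?_⟩
  obtain ⟨h, h'⟩ := hmin N'' (e.symm.toLinearMap.lTensor N'' x'') (by
    rw [rTensor_lTensor_comm, hx'', ← LinearMap.lTensor_comp_apply]
    simp)
  refine ⟨h, ?_⟩
  rw [rTensor_lTensor_comm, h', ← LinearMap.lTensor_comp_apply]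
  simp

theorem IsFlatMittagLeffler.hasLeastSupport (h : IsFlatMittagLeffler R M) {N : Type u}
    [AddCommGroup N] [Module R N] (x : N ⊗[R] M) : x.HasLeastSupport := by
  obtain ⟨ι, _, _, _, _, L, _, _, f, _, _, _, ⟨e⟩, hML⟩ := h
  suffices ∀ x : N ⊗[R] Module.DirectLimit L f, x.HasLeastSupport by
    convert! (this (e.symm.toLinearMap.lTensor N x)).of_linearEquiv e
    rw [← LinearMap.lTensor_comp_apply]
    simp
  intro x
  have := Module.Flat.directLimit f
  obtain ⟨i, z, rfl⟩ := exists_lTensor_of x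
  obtain ⟨j, hij, hj⟩ := hML i
  have hrange (k : ι) (hik : i ≤ k) : LinearMap.range (contract R N (L k) ((f i k hik).lTensor N z))
      = (LinearMap.range (f i k hik).dualMap).map (contract R N (L i) z) := by
    rw [contract_lTensor, LinearMap.range_comp]
  have hof (k : ι) (hik : i ≤ k) : (of R ι L f k).lTensor N ((f i k hik).lTensor N z) =
      (of R ι L f i).lTensor N z := by
    rw [← LinearMap.lTensor_comp_apply, of_comp]
  -- The least support is the contraction of the stable image.
  obtain ⟨y, hy⟩ := exists_rTensor_subtype_eq_lTensor _ _ (of R ι L f j) (hrange j hij).le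
  refine ⟨_, y, hy.trans (hof j hij), fun N'' x'' hx'' => ?_⟩
  have hle : (LinearMap.range (f i j hij).dualMap).map (contract R N (L i) z) ≤ N'' := by
    -- At a late enough stage `m` the lift `x''` and `z` give the same tensor; its contraction lands
    -- in `N''`, and has the stable image as range.
    obtain ⟨k, w, rfl⟩ := exists_lTensor_of x''
    obtain ⟨l, hjl, hkl⟩ := exists_ge_ge j k
    rw [← of_comp hkl, LinearMap.lTensor_comp_apply, ← hof l (hij.trans hjl),
      rTensor_lTensor_comm] at hx''
    obtain ⟨m, hlm, hm⟩ := exists_lTensor_eq_of_lTensor_of_eq hx''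
    rw [← rTensor_lTensor_comm, ← LinearMap.lTensor_comp_apply, ← LinearMap.lTensor_comp_apply,
      comp_of_directedSystem f, comp_of_directedSystem f] at hm
    rw [← hj m (hjl.trans hlm), ← hrange, ← hm]
    exact (range_contract_rTensor_le _ _).trans_eq N''.range_subtype
  refine ⟨hle, ?_⟩
  apply Module.Flat.rTensor_preserves_injective_linearMap _ N''.subtype_injective
  rw [hx'', ← LinearMap.rTensor_comp_apply, Submodule.subtype_comp_inclusion]
  exact hy.trans (hof j hij)

theorem isFlatMittagLeffler_of_forall_exists_isNondegenerate
    (h : ∀ (n : ℕ) (x : (Fin n → R) ⊗[R] M), ∃ (W : Submodule R (Fin n → R)) (x' : W ⊗[R] M),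
      x'.IsNondegenerate ∧ W.subtype.rTensor M x' = x) : IsFlatMittagLeffler R M := by
  have := flat_of_forall_exists_isNondegenerate h
  obtain ⟨ι, i₁, i₂, i₃, i₄, L, i₅, i₆, f, i₇, hfree, hfin, ⟨e⟩⟩ :=
    Module.Flat.exists_directLimit_equiv R M
  refine ⟨ι, i₁, i₂, i₃, i₄, L, i₅, i₆, f, i₇, hfree, hfin, ⟨e⟩, fun i => ?_⟩
  let g (k : ι) : L k →ₗ[R] M := e.toLinearMap ∘ₗ of R ι L f k
  have hg {k l : ι} (hkl : k ≤ l) : g l ∘ₗ f k l hkl = g k := by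
    simp only [g, LinearMap.comp_assoc, of_comp]
  -- With this `z`, the contraction at stage `k` is the dual transition map itself, so its range is
  -- the image to be controlled.
  obtain ⟨z, hz⟩ := exists_contract_eq_id R (L i)
  have hrange (k : ι) (hik : i ≤ k) : LinearMap.range
      (contract R (Module.Dual R (L i)) (L k) ((f i k hik).lTensor _ z)) =
        LinearMap.range (f i k hik).dualMap := by
    rw [contract_lTensor, hz, LinearMap.id_comp]
  have hof (k : ι) (hik : i ≤ k) : (g k).lTensor (Module.Dual R (L i))
      ((f i k hik).lTensor _ z) = (g i).lTensor _ z := by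
    rw [← LinearMap.lTensor_comp_apply, hg]
  obtain ⟨n, ⟨b⟩⟩ : ∃ n : ℕ, Nonempty (Module.Dual R (L i) ≃ₗ[R] (Fin n → R)) :=
    ⟨_, ⟨((Module.Free.chooseBasis R (Module.Dual R (L i))).reindex
      (Fintype.equivFin _)).equivFun⟩⟩
  obtain ⟨W, y, hy, hyx⟩ := h n (b.toLinearMap.rTensor M ((g i).lTensor _ z))
  let θ : W →ₗ[R] Module.Dual R (L i) := b.symm.toLinearMap ∘ₗ W.subtype
  have hθ : θ.rTensor M y = (g i).lTensor _ z := by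
    rw [LinearMap.rTensor_comp_apply, hyx, ← LinearMap.rTensor_comp_apply]
    simp
  have hle (k : ι) (hik : i ≤ k) : LinearMap.range θ ≤ LinearMap.range (f i k hik).dualMap := by
    obtain ⟨v, hv⟩ := exists_rTensor_subtype_eq_lTensor _ _ (g k) (hrange k hik).le
    exact hy.range_le θ _ v (hv.trans ((hof k hik).trans hθ.symm))
  -- Conversely, `y` is defined at a finite stage, and at a later stage `j` its image under `θ`
  -- equals that of `z`; there the contraction factors through `θ`.
  obtain ⟨k, v, hv⟩ := exists_lTensor_of (e.symm.toLinearMap.lTensor W y)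
  obtain ⟨l, hil, hkl⟩ := exists_ge_ge i k
  obtain ⟨j, hlj, hj⟩ : ∃ j, ∃ hlj : l ≤ j, θ.rTensor (L j)
      ((f k j (hkl.trans hlj)).lTensor W v) = (f i j (hil.trans hlj)).lTensor _ z := by
    have h' : (of R ι L f l).lTensor _ (θ.rTensor (L l) ((f k l hkl).lTensor W v)) =
        (of R ι L f l).lTensor _ ((f i l hil).lTensor _ z) := by
      rw [← rTensor_lTensor_comm, ← LinearMap.lTensor_comp_apply, of_comp, hv,
        rTensor_lTensor_comm, hθ, ← LinearMap.lTensor_comp_apply, ← LinearMap.lTensor_comp_apply,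
        of_comp, ← LinearMap.comp_assoc]
      simp
    obtain ⟨j, hlj, hj⟩ := exists_lTensor_eq_of_lTensor_of_eq h'
    rw [← rTensor_lTensor_comm, ← LinearMap.lTensor_comp_apply, ← LinearMap.lTensor_comp_apply,
      comp_of_directedSystem f, comp_of_directedSystem f] at hj
    exact ⟨j, hlj, hj⟩
  have hjle : LinearMap.range (f i j (hil.trans hlj)).dualMap ≤ LinearMap.range θ := by
    rw [← hrange, ← hj]
    exact range_contract_rTensor_le _ _
  refine ⟨j, hil.trans hlj, fun k hjk => le_antisymm ?_ (hjle.trans (hle k _))⟩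
  rw [← comp_of_directedSystem f (hil.trans hlj) hjk, ← LinearMap.dualMap_comp_dualMap]
  exact LinearMap.range_comp_le_range _ _

end MittagLeffler

/-! ### The equivalences -/

section Equivalences

open TensorProduct ModuleFunctor

variable {R : Type u} [CommRing R] {M : Type u} [AddCommGroup M] [Module R M]

lemma hasSmallestSubmoduleScheme_of_forall_hasLeastSupport
    (h : ∀ (N : Type u) [AddCommGroup N] [Module R N] (x : N ⊗[R] M), x.HasLeastSupport)
    {N : Type u} [AddCommGroup N] [Module R N] (f : Hom (dual R N) (quasiCoherent R M)) :
    HasSmallestSubmoduleScheme f := by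
  have := flat_of_forall_hasLeastSupport h
  obtain ⟨x, rfl⟩ := exists_ofTensor_eq f
  obtain ⟨N', x', rfl, hmin⟩ := h N x
  have hx' : x'.IsNondegenerate :=
    isNondegenerate_of_least fun N'' x'' hx'' => (hmin N'' x'' hx'').1
  refine ⟨(ofTensor x').range, ⟨?_, ?_⟩, ?_⟩
  · exact Hom.isModuleScheme_range _ ((forall_injective_ofTensor_iff x').2 hx')
  · exact Sub.factors_iff.2 ((range_ofTensor_le_iff _ _).2 ⟨N'.subtype, rfl⟩)
  · rintro S ⟨hS, hSf⟩
    obtain ⟨W, _, _, g, hg, rfl⟩ := hS.exists_eq_range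
    obtain ⟨y, rfl⟩ := exists_ofTensor_eq g
    rw [forall_injective_ofTensor_iff] at hg
    obtain ⟨θ, hθ⟩ := (range_ofTensor_le_iff _ _).1 (Sub.factors_iff.1 hSf)
    -- A competing scheme is a nondegenerate `y` with a map `θ` to `N`. Since `θ` lands in `N'`,
    -- flatness makes it carry `y` to `x'`.
    have hle : LinearMap.range θ ≤ N' := hg.range_le θ N' x' hθ.symm
    refine (range_ofTensor_le_iff _ _).2
      ⟨θ.codRestrict N' fun w => hle ⟨w, rfl⟩, ?_⟩
    apply Module.Flat.rTensor_preserves_injective_linearMap _ N'.subtype_injective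
    rw [← LinearMap.rTensor_comp_apply, LinearMap.subtype_comp_codRestrict, hθ]

lemma HasSmallestSubmoduleScheme.of_comp {X Y Z : ModuleFunctor R} {f : Hom Y X} (g : Hom Z Y)
    (hg : ∀ (A : Type u) [CommRing A] [Algebra R A], Function.Surjective (g.app A))
    (h : HasSmallestSubmoduleScheme (f.comp g)) : HasSmallestSubmoduleScheme f := by
  simpa only [HasSmallestSubmoduleScheme, Sub.factors_iff, Hom.range_comp f g hg] using h

/-- Any submodule scheme containing the image of `x` gives a nondegenerate `y` with `θ(y) = x`;
passing to the range of `θ` keeps nondegeneracy and turns `W` into a submodule of `R^n`. -/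
lemma exists_isNondegenerate_of_hasSmallestSubmoduleScheme {n : ℕ}
    (h : ∀ f : Hom (power R n) (quasiCoherent R M), HasSmallestSubmoduleScheme f)
    (x : (Fin n → R) ⊗[R] M) : ∃ (W : Submodule R (Fin n → R)) (x' : W ⊗[R] M),
      x'.IsNondegenerate ∧ W.subtype.rTensor M x' = x := by
  let e := (dualToPower R n).inverse (dualToPower_bijective n)
  obtain ⟨S, ⟨hS, hSf⟩, -⟩ := h ((ofTensor x).comp e)
  obtain ⟨W, _, _, g, hg, rfl⟩ := hS.exists_eq_range
  obtain ⟨y, rfl⟩ := exists_ofTensor_eq g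
  rw [forall_injective_ofTensor_iff] at hg
  rw [Sub.factors_iff, Hom.range_comp _ _ (Hom.inverse_surjective _ _)] at hSf
  obtain ⟨θ, rfl⟩ := (range_ofTensor_le_iff _ _).1 hSf
  refine ⟨LinearMap.range θ, θ.rangeRestrict.rTensor M y,
    hg.rTensor_surjective θ.surjective_rangeRestrict, ?_⟩
  rw [← LinearMap.rTensor_comp_apply]
  rfl

lemma hasLeastSupport_iff {N : Type u} [AddCommGroup N] [Module R N] (x : M ⊗[R] N) :
    (TensorProduct.comm R M N x).HasLeastSupport ↔
      ∃ (N' : Submodule R N) (x' : M ⊗[R] N'), N'.subtype.lTensor M x' = x ∧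
        ∀ (N'' : Submodule R N) (x'' : M ⊗[R] N''), N''.subtype.lTensor M x'' = x →
          ∃ h : N' ≤ N'', (Submodule.inclusion h).lTensor M x' = x'' := by
  have hcomm {N₁ N₂ : Type u} [AddCommGroup N₁] [Module R N₁] [AddCommGroup N₂] [Module R N₂]
      (g : N₁ →ₗ[R] N₂) (y : M ⊗[R] N₁) (z : M ⊗[R] N₂) :
      g.rTensor M (TensorProduct.comm R M N₁ y) = TensorProduct.comm R M N₂ z ↔
        g.lTensor M y = z := by
    rw [← LinearMap.comm_comp_lTensor_comp_comm_eq]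
    simp
  refine exists_congr fun N' => ?_
  rw [(TensorProduct.comm R M N').surjective.exists]
  simp only [(TensorProduct.comm R M _).surjective.forall, hcomm]

end Equivalences

theorem mainTheorem9 (R : Type u) [CommRing R] (M : Type u) [AddCommGroup M] [Module R M] :
    List.TFAE [
      -- (1)
      IsFlatMittagLeffler R M,
      -- (2)
      ∀ (N : Type u) [AddCommGroup N] [Module R N]
        (f : ModuleFunctor.Hom (ModuleFunctor.dual R N) (ModuleFunctor.quasiCoherent R M)),
        ModuleFunctor.HasSmallestSubmoduleScheme f,
      -- (3)
      ∀ (n : ℕ)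
        (f : ModuleFunctor.Hom (ModuleFunctor.power R n) (ModuleFunctor.quasiCoherent R M)),
        ModuleFunctor.HasSmallestSubmoduleScheme f,
      -- (4)
      ∀ (n : ℕ) (x : (Fin n → R) ⊗[R] M),
        ∃ (W : Submodule R (Fin n → R)) (x' : W ⊗[R] M),
          (∀ (V : Type u) [AddCommGroup V] [Module R V] (φ : W →ₗ[R] V),
            φ ≠ 0 → φ.rTensor M x' ≠ 0) ∧
          W.subtype.rTensor M x' = x,
      -- (5)
      ∀ (N : Type u) [AddCommGroup N] [Module R N]
        (f : ModuleFunctor.Hom (ModuleFunctor.dual R M) (ModuleFunctor.quasiCoherent R N)),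
        ∃ (N' : Submodule R N)
          (f' : ModuleFunctor.Hom (ModuleFunctor.dual R M) (ModuleFunctor.quasiCoherent R N')),
          (ModuleFunctor.quasiCoherentMap N'.subtype).comp f' = f ∧
          ∀ (N'' : Submodule R N)
            (f'' : ModuleFunctor.Hom (ModuleFunctor.dual R M)
              (ModuleFunctor.quasiCoherent R N'')),
            (ModuleFunctor.quasiCoherentMap N''.subtype).comp f'' = f →
            ∃ h : N' ≤ N'',
              (ModuleFunctor.quasiCoherentMap (Submodule.inclusion h)).comp f' = f'',
      -- (6)
      ∀ (N : Type u) [AddCommGroup N] [Module R N] (x : M ⊗[R] N),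
        ∃ (N' : Submodule R N) (x' : M ⊗[R] N'),
          N'.subtype.lTensor M x' = x ∧
          ∀ (N'' : Submodule R N) (x'' : M ⊗[R] N''),
            N''.subtype.lTensor M x'' = x →
            ∃ h : N' ≤ N'', (Submodule.inclusion h).lTensor M x' = x''] := by

  tfae_have 1 → 6 := fun h N _ _ x => (hasLeastSupport_iff x).1 (h.hasLeastSupport _)
  tfae_have 6 → 2 := fun h N _ _ f =>
    hasSmallestSubmoduleScheme_of_forall_hasLeastSupport (fun N _ _ x => by
      rw [← (TensorProduct.comm R M N).apply_symm_apply x]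
      exact (hasLeastSupport_iff _).2 (h N _)) f
  tfae_have 2 → 3 := fun h n f => HasSmallestSubmoduleScheme.of_comp
    (ModuleFunctor.dualToPower R n) (fun A _ _ => (ModuleFunctor.dualToPower_bijective n A).2)
    (h (Fin n → R) _)
  tfae_have 3 → 4 := fun h n x => by
    obtain ⟨W, x', hx', rfl⟩ := exists_isNondegenerate_of_hasSmallestSubmoduleScheme (h n) x
    exact ⟨W, x', fun V _ _ φ hφ hφx => hφ (hx' V φ hφx), rfl⟩
  tfae_have 4 → 1 := fun h => isFlatMittagLeffler_of_forall_exists_isNondegenerate fun n x => by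
    obtain ⟨W, x', hx', rfl⟩ := h n x
    exact ⟨W, x', fun V _ _ φ => not_imp_not.1 (hx' V φ), rfl⟩
  tfae_have 5 ↔ 6 := by
    have hsurj (N : Type u) [AddCommGroup N] [Module R N] :
        Function.Surjective (ModuleFunctor.ofTensor (R := R) (N := M) (M := N)) :=
      ModuleFunctor.exists_ofTensor_eq
    refine forall_congr' fun N => forall_congr' fun _ => forall_congr' fun _ => ?_
    rw [(hsurj N).forall]
    refine forall_congr' fun x => exists_congr fun N' => ?_
    rw [(hsurj N').exists]
    simp only [(hsurj _).forall, ModuleFunctor.quasiCoherentMap_comp_ofTensor,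
      ModuleFunctor.ofTensor_injective.eq_iff]
  tfae_finish
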